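/- Let $n \ge 1$ be an integer. For $\rho>0$ let $B_\rho=\{x\in\mathbb{R}^n : |x|<\rho\}$, and let $u_r(x)=\frac{x}{|x|}\cdot\nabla u(x)$ for $x\neq 0$. There is a constant $C>0$, depending only on $n$, with the following property. For every $u\in C^\infty(\overline{B_1})$ that is superharmonic in $B_1$ (that is, $\Delta u\le 0$ in $B_1$), there exists a constant $t\in\mathbb{R}$, depending on $u$, such that $$\|u-t\|_{L^1(B_1\setminus B_{1/2})}\le C\,\|u_r\|_{L^1(B_1\setminus B_{1/2})}$$ and $$\|u-t\|_{L^1(B_1)}\le C\,\|u_r\|_{L^1(B_1)}.$$ -/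

import Mathlib

open MeasureTheory Metric
open scoped ContDiff ENNReal InnerProductSpace Laplacian Gradient

/-- The radial derivative `u_r(x) = (x / |x|) · ∇u(x)` of a function on `ℝⁿ` (relevant for `x ≠ 0`). -/
noncomputable def radialDeriv {n : ℕ} (u : EuclideanSpace ℝ (Fin n) → ℝ)
    (x : EuclideanSpace ℝ (Fin n)) : ℝ :=
  inner ℝ (‖x‖⁻¹ • x) (∇ u x)

/-- The `L¹` norm of `f` on the set `A`, with respect to Lebesgue measure, as an extended
nonnegative real: it is `∞` when `|f|` has infinite integral, so there is no junk value. -/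
noncomputable def L1norm {n : ℕ} (f : EuclideanSpace ℝ (Fin n) → ℝ)
    (A : Set (EuclideanSpace ℝ (Fin n))) : ℝ≥0∞ :=
  eLpNorm f 1 (volume.restrict A)

open Filter Topology NNReal

/-! Both inequalities follow from a stronger one, with the full ball on the left and only the
annulus on the right: `‖u - t‖` in `L¹(B_1)` is at most `C` times `‖u_r‖` in `L¹(B_1 \ B_{1/2})`. It
is proved by contradiction and compactness. If it fails, normalization gives superharmonic `v_k`
with mean zero, `L¹` norm 1 and radial derivatives tending to zero in `L¹` of the annulus.

Superharmonicity gives `Δ v_k` a sign, so its `L¹` norm on `B_{7/8}` is bounded by testing against a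
radial cutoff; the gradient of the cutoff is radial and lives in the annulus, so only `u_r` appears
(`exists_lintegral_laplacian_le`). Integrating `u_r` along rays shows that `v_k(x) - v_k(s x)` tends
to zero in `L¹` (`lintegral_sub_dilation_le`).

For a smooth radial kernel `K`, the distance from `v_k` to its `K`-average is controlled by `Δ v_k`
(`exists_averaging_kernel`), while the averages are equi-Lipschitz. Arzelà–Ascoli thus gives an `L¹`
limit `w` that equals its own `K`-average and is dilation invariant in the annulus. A maximum
principle forces `w` to be constant (`le_apply_zero_of_mean_value`). Dilations carry the convergence
out to `B_1`, and a constant limit contradicts mean zero and norm 1. -/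

/-- Euclidean space of dimension `n`. -/
abbrev Euc (n : ℕ) := EuclideanSpace ℝ (Fin n)

/-- The radial function with profile `P` in the variable `c - b |x|²`. -/
noncomputable def radialProfile {n : ℕ} (P : ℝ → ℝ) (b c : ℝ) (x : Euc n) : ℝ := P (c - b * ‖x‖ ^ 2)

/-! ### Radial test functions and Green's identity. -/

section Radial

variable {n : ℕ} {P : ℝ → ℝ} {b c : ℝ}

lemma radialProfile_contDiff (hP : ContDiff ℝ ∞ P) :
    ContDiff ℝ ∞ (radialProfile (n := n) P b c) := by
  unfold radialProfile
  exact hP.comp (contDiff_const.sub (contDiff_const.mul (contDiff_norm_sq ℝ)))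

/-- The gradient is a scalar multiple of `x`, with the profile `deriv P` of the same kind. Hence
integrating by parts against such a function leaves only derivatives of `u` in the direction of the
integration variable. -/
lemma radialProfile_fderiv (hP : ContDiff ℝ ∞ P) (x v : Euc n) :
    fderiv ℝ (radialProfile P b c) x v =
      -(2 * b * radialProfile (deriv P) b c x) * inner ℝ x v := by
  have h1 : HasFDerivAt (fun x : Euc n => c - b * ‖x‖ ^ 2) _ x :=
    (((hasStrictFDerivAt_norm_sq x).hasFDerivAt).const_mul b).const_sub c
  have h2 : HasDerivAt P (deriv P (c - b * ‖x‖ ^ 2)) (c - b * ‖x‖ ^ 2) :=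
    (hP.differentiable (by simp)).differentiableAt.hasDerivAt
  have h3 := h2.comp_hasFDerivAt x h1
  have h4 : fderiv ℝ (radialProfile P b c) x = _ := h3.fderiv
  rw [h4]
  simp [radialProfile]
  ring

lemma deriv_contDiff (hP : ContDiff ℝ ∞ P) : ContDiff ℝ ∞ (deriv P) :=
  ((contDiff_succ_iff_deriv (n := ∞)).1 (by simpa using hP)).2.2

lemma deriv_eq_zero_of_nonpos (hP : ContDiff ℝ ∞ P) (h0 : ∀ t ≤ 0, P t = 0) {t : ℝ} (ht : t ≤ 0) :
    deriv P t = 0 := by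
  -- Local constancy only covers `t < 0`; the endpoint `t = 0` comes from continuity of `deriv P`.
  have h : Set.EqOn (deriv P) (fun _ => 0) (closure (Set.Iio 0)) := by
    refine Set.EqOn.closure ?_ (deriv_contDiff hP).continuous continuous_const
    intro s hs
    have : P =ᶠ[nhds s] fun _ => 0 := by
      filter_upwards [Iio_mem_nhds hs] with r hr using h0 r (le_of_lt hr)
    simpa using this.deriv_eq
  exact h (by simpa using ht)

lemma radialProfile_eq_zero (hb : 0 < b) (h0 : ∀ t ≤ 0, P t = 0) {R : ℝ} (hR : 0 ≤ R)
    (hc : c ≤ b * R ^ 2) {x : Euc n} (hx : R ≤ ‖x‖) : radialProfile P b c x = 0 := by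
  apply h0
  have : R ^ 2 ≤ ‖x‖ ^ 2 := by gcongr
  nlinarith

lemma radialProfile_hasCompactSupport (hb : 0 < b) (h0 : ∀ t ≤ 0, P t = 0) :
    HasCompactSupport (radialProfile (n := n) P b c) := by
  refine HasCompactSupport.intro (isCompact_closedBall 0 (1 + |c| / b)) fun x hx => ?_
  have hx' : 1 + |c| / b ≤ ‖x‖ := by simpa using (not_le.1 (by simpa using hx)).le
  have hq : 0 ≤ |c| / b := by positivity
  refine radialProfile_eq_zero hb h0 (by positivity) ?_ hx'
  have h1 : b * (|c| / b) = |c| := by field_simp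
  have := le_abs_self c
  nlinarith [mul_nonneg hb.le hq, mul_nonneg hb.le (sq_nonneg (|c| / b))]

lemma laplacian_eq_sum {u : Euc n → ℝ} (z : Euc n) :
    Δ u z = ∑ i, fderiv ℝ (fderiv ℝ u) z (EuclideanSpace.basisFun (Fin n) ℝ i)
      (EuclideanSpace.basisFun (Fin n) ℝ i) := by
  rw [InnerProductSpace.laplacian_eq_iteratedFDeriv_orthonormalBasis u
    (EuclideanSpace.basisFun (Fin n) ℝ)]
  simp [iteratedFDeriv_two_apply]

lemma laplacian_continuous {u : Euc n → ℝ} (hu : ContDiff ℝ 2 u) : Continuous (Δ u) := by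
  have : Δ u = fun z => ∑ i, fderiv ℝ (fderiv ℝ u) z (EuclideanSpace.basisFun (Fin n) ℝ i)
      (EuclideanSpace.basisFun (Fin n) ℝ i) := funext fun z => laplacian_eq_sum z
  rw [this]
  have h2 : Continuous (fderiv ℝ (fderiv ℝ u)) :=
    ((hu.fderiv_right (m := 1) (by norm_num)).continuous_fderiv (by norm_num))
  fun_prop

/-- Green's first identity for the rescaled function `y ↦ u (x + s y)` against a radial function. -/
lemma integral_radialProfile_mul_laplacian (hP : ContDiff ℝ ∞ P) (hb : 0 < b)
    (h0 : ∀ t ≤ 0, P t = 0) {u : Euc n → ℝ} (hu : ContDiff ℝ 2 u) (x : Euc n) (s : ℝ) :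
    ∫ y, radialProfile P b c y * (s * Δ u (x + s • y)) =
      ∫ y, 2 * b * radialProfile (deriv P) b c y * fderiv ℝ u (x + s • y) y := by
  set e := EuclideanSpace.basisFun (Fin n) ℝ
  have hφ := radialProfile_contDiff (n := n) (b := b) (c := c) hP
  have hφc := radialProfile_hasCompactSupport (n := n) (b := b) (c := c) hb h0
  have hφ'c : Continuous (fderiv ℝ (radialProfile (n := n) P b c)) :=
    hφ.continuous_fderiv (by simp)
  have hu1 : ContDiff ℝ 1 (fderiv ℝ u) := hu.fderiv_right (m := 1) (by norm_num)
  have hu1c : Continuous (fderiv ℝ u) := hu1.continuous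
  have hu2 : Continuous (fderiv ℝ (fderiv ℝ u)) := hu1.continuous_fderiv (by norm_num)
  have hg : ∀ i y, HasFDerivAt (fun y => fderiv ℝ u (x + s • y) (e i))
      (((ContinuousLinearMap.apply ℝ ℝ (e i)).comp (fderiv ℝ (fderiv ℝ u) (x + s • y))).comp
        (s • ContinuousLinearMap.id ℝ (Euc n))) y := by
    intro i y
    have h1 : HasFDerivAt (fun y : Euc n => x + s • y) (s • ContinuousLinearMap.id ℝ (Euc n)) y :=
      ((hasFDerivAt_id y).const_smul s).const_add x
    have h2 : HasFDerivAt (fderiv ℝ u) (fderiv ℝ (fderiv ℝ u) (x + s • y)) (x + s • y) :=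
      (hu1.differentiable (by norm_num)).differentiableAt.hasFDerivAt
    have h3 := (ContinuousLinearMap.apply ℝ ℝ (e i)).hasFDerivAt.comp _ h2
    exact h3.comp y h1
  have key : ∀ i, ∫ y, radialProfile P b c y *
      (s * fderiv ℝ (fderiv ℝ u) (x + s • y) (e i) (e i)) =
      -∫ y, fderiv ℝ (radialProfile P b c) y (e i) * fderiv ℝ u (x + s • y) (e i) := by
    intro i
    have := integral_mul_fderiv_eq_neg_fderiv_mul_of_integrable (μ := volume)
      (f := radialProfile (n := n) P b c) (g := fun y => fderiv ℝ u (x + s • y) (e i)) (v := e i)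
      ?_ ?_ ?_ (fun y _ => (hφ.differentiable (by simp)).differentiableAt)
      (fun y _ => (hg i y).differentiableAt)
    · rw [← this]
      congr 1
      ext y
      rw [(hg i y).fderiv]
      simp
    · refine Continuous.integrable_of_hasCompactSupport (by fun_prop) ?_
      exact (hφc.fderiv_apply ℝ (e i)).mul_right
    · refine Continuous.integrable_of_hasCompactSupport ?_ hφc.mul_right
      simp_rw [(hg i _).fderiv]
      have := hφ.continuous
      simp
      fun_prop
    · have := hφ.continuous
      refine Continuous.integrable_of_hasCompactSupport (by fun_prop) hφc.mul_right
  have hi1 : ∀ i, Integrable fun y => radialProfile P b c y *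
      (s * fderiv ℝ (fderiv ℝ u) (x + s • y) (e i) (e i)) := by
    intro i
    have := hφ.continuous
    exact Continuous.integrable_of_hasCompactSupport (by fun_prop) hφc.mul_right
  have hi2 : ∀ i, Integrable fun y => fderiv ℝ (radialProfile P b c) y (e i) *
      fderiv ℝ u (x + s • y) (e i) := by
    intro i
    refine Continuous.integrable_of_hasCompactSupport (by fun_prop) ?_
    exact (hφc.fderiv_apply ℝ (e i)).mul_right
  simp_rw [laplacian_eq_sum, Finset.mul_sum]
  rw [integral_finsetSum _ (fun i _ => hi1 i), Finset.sum_congr rfl (fun i _ => key i),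
    Finset.sum_neg_distrib, ← integral_finsetSum _ (fun i _ => hi2 i), ← integral_neg]
  congr 1
  ext y
  simp_rw [radialProfile_fderiv hP]
  -- Since the gradient of the test function is parallel to `y`, the sum over coordinates
  -- reassembles into one derivative in the direction `y`.
  have hy : fderiv ℝ u (x + s • y) y = ∑ i, inner ℝ y (e i) * fderiv ℝ u (x + s • y) (e i) := by
    have hL : ∀ L : Euc n →L[ℝ] ℝ, L y = ∑ i, inner ℝ y (e i) * L (e i) := by
      intro L
      conv_lhs => rw [← e.sum_repr' y]
      simp [real_inner_comm]
    exact hL _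
  rw [hy, Finset.mul_sum, ← Finset.sum_neg_distrib]
  refine Finset.sum_congr rfl fun i _ => ?_
  ring

end Radial

/-! ### The scalar profile behind the averaging kernel. -/

lemma expNegInvGlue_deriv_nonneg (t : ℝ) : 0 ≤ deriv expNegInvGlue t :=
  expNegInvGlue.monotone.deriv_nonneg

/-- Strict positivity makes the averaging kernel positive on its whole open ball, as the maximum
principle requires. -/
lemma expNegInvGlue_deriv_pos {t : ℝ} (ht : 0 < t) : 0 < deriv expNegInvGlue t := by
  have h : expNegInvGlue =ᶠ[nhds t] fun s => Real.exp (-s⁻¹) := by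
    filter_upwards [Ioi_mem_nhds ht] with s hs
    simp [expNegInvGlue, not_le.2 (show (0 : ℝ) < s from hs)]
  rw [h.deriv_eq]
  have h2 : HasDerivAt (fun s : ℝ => Real.exp (-s⁻¹)) (Real.exp (-t⁻¹) * -(-(t ^ 2)⁻¹)) t :=
    (hasDerivAt_inv ht.ne').neg.exp
  rw [h2.deriv]
  have := Real.exp_pos (-t⁻¹)
  have h3 : 0 < (t ^ 2)⁻¹ := by positivity
  rw [neg_neg]
  positivity

lemma expNegInvGlue_le_one (t : ℝ) : expNegInvGlue t ≤ 1 := by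
  unfold expNegInvGlue
  split_ifs with h
  · norm_num
  · have : 0 ≤ t⁻¹ := inv_nonneg.2 (not_le.1 h).le
    simpa using this

/-! ### Averaging against a radial kernel, with error controlled by the Laplacian. -/

section Kernel

variable {n : ℕ}

/-- A function minus its radial average, as an integral of the Laplacian. -/
lemma integral_kernel_sub {P : ℝ → ℝ} {b c : ℝ} (hP : ContDiff ℝ ∞ P) (hb : 0 < b)
    (h0 : ∀ t ≤ 0, P t = 0) {u : Euc n → ℝ} (hu : ContDiff ℝ 2 u) (x : Euc n) :
    ∫ y, 2 * b * radialProfile (deriv P) b c y * (u (x + y) - u x) =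
      ∫ s in Set.Icc (0 : ℝ) 1, ∫ y, radialProfile P b c y * (s * Δ u (x + s • y)) := by
  have hu1c : Continuous (fderiv ℝ u) := hu.continuous_fderiv (by norm_num)
  have hκ := (radialProfile_contDiff (n := n) (b := b) (c := c) (deriv_contDiff hP)).continuous
  have hκc := radialProfile_hasCompactSupport (n := n) (c := c) hb
    (fun t ht => deriv_eq_zero_of_nonpos hP h0 ht)
  -- After Green's identity the integrand contains `fderiv ℝ u (x + s • y) y`, the `s`-derivative of
  -- `u (x + s • y)`. Integrating over `s` in `[0, 1]` gives `u (x + y) - u x`, and Fubini finishes.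
  simp_rw [integral_radialProfile_mul_laplacian hP hb h0 hu]
  have hline : ∀ y, u (x + y) - u x = ∫ s in Set.Icc (0 : ℝ) 1, fderiv ℝ u (x + s • y) y := by
    intro y
    rw [integral_Icc_eq_integral_Ioc, ← intervalIntegral.integral_of_le zero_le_one]
    have hd : ∀ s ∈ Set.uIcc (0 : ℝ) 1,
        HasDerivAt (fun s : ℝ => u (x + s • y)) (fderiv ℝ u (x + s • y) y) s := by
      intro s _
      have h1 : HasDerivAt (fun s : ℝ => x + s • y) y s := by
        simpa using ((hasDerivAt_id s).smul_const y).const_add x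
      exact ((hu.differentiable (by norm_num)).differentiableAt.hasFDerivAt).comp_hasDerivAt s h1
    rw [intervalIntegral.integral_eq_sub_of_hasDerivAt hd
      (Continuous.intervalIntegrable (by fun_prop) _ _)]
    simp
  simp_rw [hline, ← integral_const_mul]
  refine integral_integral_swap ?_
  have hcont : Continuous (Function.uncurry fun (y : Euc n) (s : ℝ) =>
      2 * b * radialProfile (deriv P) b c y * fderiv ℝ u (x + s • y) y) := by
    unfold Function.uncurry
    have hκ' : Continuous fun p : Euc n × ℝ => radialProfile (deriv P) b c p.1 :=
      hκ.comp continuous_fst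
    have hf : Continuous fun p : Euc n × ℝ => fderiv ℝ u (x + p.2 • p.1) :=
      hu1c.comp (by fun_prop)
    exact (continuous_const.mul hκ').mul (hf.clm_apply continuous_fst)
  have hI : IntegrableOn (Function.uncurry fun (y : Euc n) (s : ℝ) =>
      2 * b * radialProfile (deriv P) b c y * fderiv ℝ u (x + s • y) y)
      (tsupport (radialProfile (n := n) (deriv P) b c) ×ˢ Set.Icc (0 : ℝ) 1)
      (volume.prod volume) :=
    hcont.continuousOn.integrableOn_compact (hκc.isCompact.prod isCompact_Icc)
  have hI2 : IntegrableOn (Function.uncurry fun (y : Euc n) (s : ℝ) =>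
      2 * b * radialProfile (deriv P) b c y * fderiv ℝ u (x + s • y) y)
      (Set.univ ×ˢ Set.Icc (0 : ℝ) 1) (volume.prod volume) := by
    refine hI.of_forall_sdiff_eq_zero (MeasurableSet.univ.prod measurableSet_Icc) ?_
    rintro ⟨y, s⟩ ⟨⟨-, hs⟩, h⟩
    have : y ∉ tsupport (radialProfile (n := n) (deriv P) b c) := fun hy => h ⟨hy, hs⟩
    simp [image_eq_zero_of_notMem_tsupport this]
  unfold IntegrableOn at hI2
  rwa [← Measure.prod_restrict, Measure.restrict_univ] at hI2

/-- In the Laplacian formula both `P` and `s` are at most 1 in absolute value, and `x + s • y` stays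
in the ball of radius `a + r`. For fixed `s` and `y` the `x`-integral is a translate, so integrating
over `y` only costs the volume of the small ball. -/
lemma enorm_integral_kernel_sub_le {P : ℝ → ℝ} {b c r : ℝ} (hP : ContDiff ℝ ∞ P) (hb : 0 < b)
    (h0 : ∀ t ≤ 0, P t = 0) (hP1 : ∀ t, |P t| ≤ 1) (hr : 0 ≤ r) (hc : c ≤ b * r ^ 2)
    {u : Euc n → ℝ} (hu : ContDiff ℝ 2 u) (a : ℝ) :
    ∫⁻ x in ball (0 : Euc n) a,
        ‖∫ y, 2 * b * radialProfile (deriv P) b c y * (u (x + y) - u x)‖ₑ ≤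
      volume (ball (0 : Euc n) r) * ∫⁻ x in ball (0 : Euc n) (a + r), ‖Δ u x‖ₑ := by
  have hΔ := laplacian_continuous hu
  have step1 : ∀ x, ‖∫ y, 2 * b * radialProfile (deriv P) b c y * (u (x + y) - u x)‖ₑ ≤
      ∫⁻ s in Set.Icc (0 : ℝ) 1, ∫⁻ y in ball (0 : Euc n) r, ‖Δ u (x + s • y)‖ₑ := by
    intro x
    rw [integral_kernel_sub hP hb h0 hu x]
    refine (enorm_integral_le_lintegral_enorm _).trans ?_
    refine setLIntegral_mono' measurableSet_Icc fun s hs => ?_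
    refine (enorm_integral_le_lintegral_enorm _).trans ?_
    rw [← lintegral_indicator measurableSet_ball]
    refine lintegral_mono fun y => ?_
    by_cases hy : y ∈ ball (0 : Euc n) r
    · rw [Set.indicator_of_mem hy, enorm_mul, enorm_mul]
      have h1 : ‖radialProfile P b c y‖ₑ ≤ 1 := by
        rw [← ofReal_norm, Real.norm_eq_abs]
        exact ENNReal.ofReal_le_one.2 (hP1 _)
      have h2 : ‖s‖ₑ ≤ 1 := by
        rw [← ofReal_norm, Real.norm_eq_abs, abs_of_nonneg hs.1]
        exact ENNReal.ofReal_le_one.2 hs.2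
      calc _ ≤ 1 * (1 * ‖Δ u (x + s • y)‖ₑ) := by gcongr
        _ = _ := by simp
    · rw [radialProfile_eq_zero hb h0 hr hc (by simpa using hy)]
      simp
  calc _ ≤ ∫⁻ x in ball (0 : Euc n) a, ∫⁻ s in Set.Icc (0 : ℝ) 1,
        ∫⁻ y in ball (0 : Euc n) r, ‖Δ u (x + s • y)‖ₑ := lintegral_mono fun x => step1 x
    _ = ∫⁻ s in Set.Icc (0 : ℝ) 1, ∫⁻ x in ball (0 : Euc n) a,
        ∫⁻ y in ball (0 : Euc n) r, ‖Δ u (x + s • y)‖ₑ := by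
        refine lintegral_lintegral_swap (Measurable.aemeasurable ?_)
        refine Measurable.lintegral_prod_right' (ν := volume.restrict (ball (0 : Euc n) r))
          (f := fun q : (Euc n × ℝ) × Euc n => ‖Δ u (q.1.1 + q.1.2 • q.2)‖ₑ) ?_
        exact (hΔ.comp (by fun_prop)).measurable.enorm
    _ = ∫⁻ s in Set.Icc (0 : ℝ) 1, ∫⁻ y in ball (0 : Euc n) r,
        ∫⁻ x in ball (0 : Euc n) a, ‖Δ u (x + s • y)‖ₑ := by
        refine lintegral_congr fun s => ?_
        refine lintegral_lintegral_swap (Measurable.aemeasurable ?_)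
        exact (hΔ.comp (by fun_prop)).measurable.enorm
    _ ≤ ∫⁻ s in Set.Icc (0 : ℝ) 1, ∫⁻ y in ball (0 : Euc n) r,
        ∫⁻ x in ball (0 : Euc n) (a + r), ‖Δ u x‖ₑ := by
        refine setLIntegral_mono' measurableSet_Icc fun s hs => ?_
        refine setLIntegral_mono' measurableSet_ball fun y hy => ?_
        rw [← lintegral_indicator measurableSet_ball, ← lintegral_indicator measurableSet_ball,
          ← lintegral_add_right_eq_self ((ball (0 : Euc n) (a + r)).indicator _) (s • y)]
        refine lintegral_mono fun x => ?_
        by_cases hx : x ∈ ball (0 : Euc n) a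
        · have : x + s • y ∈ ball (0 : Euc n) (a + r) := by
            simp only [mem_ball_zero_iff] at *
            calc ‖x + s • y‖ ≤ ‖x‖ + ‖s • y‖ := norm_add_le _ _
              _ = ‖x‖ + s * ‖y‖ := by rw [norm_smul, Real.norm_eq_abs, abs_of_nonneg hs.1]
              _ < a + r := by nlinarith [norm_nonneg y, hs.1, hs.2]
          rw [Set.indicator_of_mem hx, Set.indicator_of_mem this]
        · simp [Set.indicator_of_notMem hx]
    _ = _ := by simp [mul_comm]

/-- A smooth probability kernel supported in the ball of radius `1 / 16`, for which the distance
of a function to its average is controlled by the Laplacian. -/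
lemma exists_averaging_kernel :
    ∃ K : Euc n → ℝ, ContDiff ℝ ∞ K ∧ HasCompactSupport K ∧ (∀ y, 0 ≤ K y) ∧
      (∀ y, ‖y‖ < 1 / 16 → 0 < K y) ∧ (∀ y, 1 / 16 ≤ ‖y‖ → K y = 0) ∧
      ∫ y, K y = 1 ∧ ∃ C : ℝ≥0∞, C ≠ ⊤ ∧ ∀ u : Euc n → ℝ, ContDiff ℝ 2 u → ∀ a : ℝ,
        ∫⁻ x in ball (0 : Euc n) a, ‖u x - ∫ y, K y * u (x + y)‖ₑ ≤
          C * ∫⁻ x in ball (0 : Euc n) (a + 1 / 16), ‖Δ u x‖ₑ := by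
  have hP : ContDiff ℝ ∞ expNegInvGlue := expNegInvGlue.contDiff
  have h0 : ∀ t ≤ 0, expNegInvGlue t = 0 := fun t ht => expNegInvGlue.zero_of_nonpos ht
  have hP' := deriv_contDiff hP
  have h0' : ∀ t ≤ 0, deriv expNegInvGlue t = 0 := fun t ht => deriv_eq_zero_of_nonpos hP h0 ht
  -- Here `b = 1` and `c = (1 / 16) ^ 2`, so the argument of the profile is positive exactly when
  -- `‖y‖ < 1 / 16`. The form matches the kernel of `integral_kernel_sub`.
  set κ : Euc n → ℝ := fun y => 2 * 1 * radialProfile (deriv expNegInvGlue) 1 (1 / 256) y with hκ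
  have hκs : ContDiff ℝ ∞ κ := contDiff_const.mul (radialProfile_contDiff hP')
  have hκc : HasCompactSupport κ :=
    (radialProfile_hasCompactSupport (n := n) (b := 1) (c := 1 / 256) one_pos h0').mul_left
  have hκ0 : ∀ y, 0 ≤ κ y := fun y => mul_nonneg (by norm_num) (expNegInvGlue_deriv_nonneg _)
  have hκp : ∀ y, ‖y‖ < 1 / 16 → 0 < κ y := by
    intro y hy
    refine mul_pos (by norm_num) (expNegInvGlue_deriv_pos ?_)
    nlinarith [norm_nonneg y]
  have hκz : ∀ y, 1 / 16 ≤ ‖y‖ → κ y = 0 := by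
    intro y hy
    have := radialProfile_eq_zero (P := deriv expNegInvGlue) (b := 1) (c := 1 / 256) one_pos h0'
      (R := 1 / 16) (by norm_num) (by norm_num) hy
    simp only [hκ, this, mul_zero]
  have hκi : Integrable κ := hκs.continuous.integrable_of_hasCompactSupport hκc
  have hm : 0 < ∫ y, κ y :=
    hκs.continuous.integral_pos_of_hasCompactSupport_nonneg_nonzero hκc hκ0
      (hκp 0 (by norm_num)).ne'
  set m := ∫ y, κ y with hmdef
  refine ⟨fun y => m⁻¹ * κ y, contDiff_const.mul hκs, hκc.mul_left,
    fun y => mul_nonneg (inv_nonneg.2 hm.le) (hκ0 y),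
    fun y hy => mul_pos (inv_pos.2 hm) (hκp y hy), fun y hy => by simp [hκz y hy], ?_,
    ‖m⁻¹‖ₑ * volume (ball (0 : Euc n) (1 / 16)), ?_, ?_⟩
  · rw [integral_const_mul, ← hmdef, inv_mul_cancel₀ hm.ne']
  · exact ENNReal.mul_ne_top enorm_ne_top measure_ball_lt_top.ne
  · intro u hu a
    have hi1 : ∀ x, Integrable fun y => κ y * u (x + y) := fun x => by
      have := hκs.continuous
      have := hu.continuous
      exact Continuous.integrable_of_hasCompactSupport (by fun_prop) hκc.mul_right
    have heq : ∀ x, u x - ∫ y, m⁻¹ * κ y * u (x + y) =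
        -(m⁻¹ * ∫ y, κ y * (u (x + y) - u x)) := by
      intro x
      simp_rw [mul_sub, mul_assoc, integral_const_mul]
      rw [integral_sub (hi1 x) (hκi.mul_const _), integral_mul_const, ← hmdef]
      field_simp
      ring
    have main := enorm_integral_kernel_sub_le (n := n) (c := 1 / 256) (r := 1 / 16) hP one_pos h0
      (fun t => by rw [abs_of_nonneg (expNegInvGlue.nonneg t)]; exact expNegInvGlue_le_one t)
      (by norm_num) (by norm_num) hu a
    simp_rw [heq, enorm_neg, enorm_mul]
    rw [lintegral_const_mul' _ _ enorm_ne_top, mul_assoc]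
    gcongr
end Kernel

/-! ### What the radial derivative controls: dilations and the Laplacian. -/

section RadialDeriv

variable {n : ℕ}

/-- The factor `‖x‖` undoes the normalization in `radialDeriv`; at the origin both sides vanish. -/
lemma fderiv_apply_self (u : Euc n → ℝ) (x : Euc n) :
    fderiv ℝ u x x = ‖x‖ * radialDeriv u x := by
  have h : fderiv ℝ u x x = inner ℝ x (∇ u x) := by
    rw [← toDual_gradient, InnerProductSpace.toDual_apply_apply, real_inner_comm]
  rw [h, radialDeriv, inner_smul_left]
  rcases eq_or_ne x 0 with rfl | hx
  · simp
  · have : ‖x‖ ≠ 0 := norm_ne_zero_iff.2 hx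
    simp
    field_simp

lemma measurable_radialDeriv (u : Euc n → ℝ) : Measurable (radialDeriv u) := by
  unfold radialDeriv gradient
  have h : Measurable fun x => (InnerProductSpace.toDual ℝ (Euc n)).symm (fderiv ℝ u x) :=
    (LinearIsometryEquiv.continuous _).measurable.comp (measurable_fderiv ℝ u)
  exact (measurable_norm.inv.smul measurable_id).inner h

lemma radialDeriv_congr {u v : Euc n → ℝ} {x : Euc n} (h : u =ᶠ[nhds x] v) :
    radialDeriv u x = radialDeriv v x := by
  unfold radialDeriv gradient
  rw [h.fderiv_eq]

/-- Change of variables with Jacobian `τ ^ n`, after enlarging `T` to the preimage of `S`. -/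
lemma lintegral_comp_smul_le {f : Euc n → ℝ≥0∞} (hf : Measurable f) {S T : Set (Euc n)}
    (hS : MeasurableSet S) (hT : MeasurableSet T) {τ : ℝ} (hτ : 0 < τ)
    (h : ∀ x ∈ T, τ • x ∈ S) :
    ∫⁻ x in T, f (τ • x) ≤ ENNReal.ofReal (τ ^ n)⁻¹ * ∫⁻ x in S, f x := by
  calc ∫⁻ x in T, f (τ • x) ≤ ∫⁻ x, S.indicator f (τ • x) := by
        rw [← lintegral_indicator hT]
        refine lintegral_mono fun x => ?_
        by_cases hx : x ∈ T
        · simp [Set.indicator_of_mem hx, Set.indicator_of_mem (h x hx)]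
        · simp [Set.indicator_of_notMem hx]
    _ = ∫⁻ x, S.indicator f x ∂(Measure.map (τ • ·) volume) := by
        rw [lintegral_map (hf.indicator hS) (measurable_const_smul τ)]
    _ = _ := by
        rw [Measure.map_addHaar_smul _ hτ.ne', lintegral_smul_measure, lintegral_indicator hS]
        simp [abs_of_pos (pow_pos hτ n)]

/-- The effect of a dilation on a function is controlled by its radial derivative. -/
lemma lintegral_sub_dilation_le {u : Euc n → ℝ} (hu : ContDiffOn ℝ 1 u (ball 0 1)) {s : ℝ}
    (hs0 : 0 < s) (hs1 : s ≤ 1) :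
    ∫⁻ x in ball (0 : Euc n) 1 \ ball 0 (1 / (2 * s)), ‖u x - u (s • x)‖ₑ ≤
      ENNReal.ofReal (s⁻¹ * (s ^ n)⁻¹) *
        ∫⁻ x in ball (0 : Euc n) 1 \ ball 0 (1 / 2), ‖radialDeriv u x‖ₑ := by
  set T := ball (0 : Euc n) 1 \ ball 0 (1 / (2 * s))
  set A := ball (0 : Euc n) 1 \ ball 0 (1 / 2)
  have hT : MeasurableSet T := measurableSet_ball.diff measurableSet_ball
  have hA : MeasurableSet A := measurableSet_ball.diff measurableSet_ball
  have hrd := measurable_radialDeriv u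
  have hball : ∀ x ∈ ball (0 : Euc n) 1, ∀ τ ∈ Set.Icc s 1, τ • x ∈ ball (0 : Euc n) 1 := by
    intro x hx τ hτ
    have h0 : 0 < τ := hs0.trans_le hτ.1
    simp only [mem_ball_zero_iff, norm_smul, Real.norm_eq_abs, abs_of_pos h0] at *
    nlinarith [norm_nonneg x, hτ.2]
  -- Fundamental theorem of calculus along the ray from `s • x` to `x`. Removing the ball of radius
  -- `1 / (2 * s)` keeps `τ • x` outside `B_{1/2}` for every `τ ≥ s`.
  have hpt : ∀ x ∈ T, ‖u x - u (s • x)‖ₑ ≤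
      ∫⁻ τ in Set.Icc s 1, ENNReal.ofReal s⁻¹ * ‖radialDeriv u (τ • x)‖ₑ := by
    intro x hx
    have hfd : ContinuousOn (fderiv ℝ u) (ball 0 1) :=
      hu.continuousOn_fderiv_of_isOpen isOpen_ball (by norm_num)
    have hd : ∀ τ ∈ Set.uIcc s 1,
        HasDerivAt (fun τ : ℝ => u (τ • x)) (fderiv ℝ u (τ • x) x) τ := by
      intro τ hτ
      rw [Set.uIcc_of_le hs1] at hτ
      have h1 : HasDerivAt (fun τ : ℝ => τ • x) x τ := by
        simpa using (hasDerivAt_id τ).smul_const x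
      have h2 : DifferentiableAt ℝ u (τ • x) :=
        (hu.contDiffAt (isOpen_ball.mem_nhds (hball x hx.1 τ hτ))).differentiableAt (by norm_num)
      exact h2.hasFDerivAt.comp_hasDerivAt τ h1
    have hint : IntervalIntegrable (fun τ : ℝ => fderiv ℝ u (τ • x) x) volume s 1 := by
      refine ContinuousOn.intervalIntegrable ?_
      rw [Set.uIcc_of_le hs1]
      refine ContinuousOn.clm_apply ?_ continuousOn_const
      exact hfd.comp (by fun_prop) fun τ hτ => hball x hx.1 τ hτ
    have hftc := intervalIntegral.integral_eq_sub_of_hasDerivAt hd hint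
    rw [one_smul, intervalIntegral.integral_of_le hs1, ← integral_Icc_eq_integral_Ioc] at hftc
    rw [← hftc]
    refine (enorm_integral_le_lintegral_enorm _).trans ?_
    refine setLIntegral_mono' measurableSet_Icc fun τ hτ => ?_
    have h0 : 0 < τ := hs0.trans_le hτ.1
    have h1 : fderiv ℝ u (τ • x) x = ‖x‖ * radialDeriv u (τ • x) := by
      have := fderiv_apply_self u (τ • x)
      rw [map_smul, norm_smul, Real.norm_eq_abs, abs_of_pos h0, smul_eq_mul, mul_assoc] at this
      exact mul_left_cancel₀ h0.ne' this
    rw [h1, enorm_mul]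
    gcongr
    rw [enorm_norm, ← ofReal_norm]
    refine ENNReal.ofReal_le_ofReal ?_
    have : ‖x‖ < 1 := by simpa using hx.1
    exact this.le.trans (one_le_inv_iff₀.2 ⟨hs0, hs1⟩)
  calc _ ≤ ∫⁻ x in T, ∫⁻ τ in Set.Icc s 1, ENNReal.ofReal s⁻¹ * ‖radialDeriv u (τ • x)‖ₑ :=
        setLIntegral_mono' hT hpt
    _ = ∫⁻ τ in Set.Icc s 1, ∫⁻ x in T, ENNReal.ofReal s⁻¹ * ‖radialDeriv u (τ • x)‖ₑ := by
        refine lintegral_lintegral_swap (Measurable.aemeasurable ?_)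
        refine Measurable.const_mul ?_ _
        exact (hrd.comp (by fun_prop : Measurable fun p : Euc n × ℝ => p.2 • p.1)).enorm
    _ ≤ ∫⁻ τ in Set.Icc s 1, ENNReal.ofReal (s⁻¹ * (s ^ n)⁻¹) *
          ∫⁻ x in A, ‖radialDeriv u x‖ₑ := by
        refine setLIntegral_mono' measurableSet_Icc fun τ hτ => ?_
        have h0 : 0 < τ := hs0.trans_le hτ.1
        rw [lintegral_const_mul' _ _ ENNReal.ofReal_ne_top,
          ENNReal.ofReal_mul (inv_nonneg.2 hs0.le), mul_assoc]
        gcongr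
        refine (lintegral_comp_smul_le (f := fun x => ‖radialDeriv u x‖ₑ) hrd.enorm hA hT h0
          ?_).trans ?_
        · intro x hx
          refine ⟨hball x hx.1 τ hτ, ?_⟩
          have h2 : 1 / (2 * s) ≤ ‖x‖ := by simpa using hx.2
          rw [div_le_iff₀ (by positivity)] at h2
          simp only [mem_ball_zero_iff, norm_smul, Real.norm_eq_abs, abs_of_pos h0, not_lt]
          nlinarith [norm_nonneg x, hτ.1]
        · gcongr
          exact hτ.1
    _ ≤ _ := by
        rw [setLIntegral_const, Real.volume_Icc]
        refine mul_le_of_le_one_right' ?_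
        exact ENNReal.ofReal_le_one.2 (by linarith)

/-- The `L¹` norm of the Laplacian of a superharmonic function in an interior ball is controlled
by the radial derivative in an annulus. -/
lemma exists_lintegral_laplacian_le :
    ∃ C : ℝ≥0∞, C ≠ ⊤ ∧ ∀ u : Euc n → ℝ, ContDiff ℝ 2 u → (∀ x ∈ ball 0 (15 / 16), Δ u x ≤ 0) →
      ∫⁻ x in ball (0 : Euc n) (7 / 8), ‖Δ u x‖ₑ ≤
        C * ∫⁻ x in ball (0 : Euc n) (15 / 16) \ ball 0 (1 / 2), ‖radialDeriv u x‖ₑ := by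
  have hP : ContDiff ℝ ∞ Real.smoothTransition := Real.smoothTransition.contDiff
  have h0 : ∀ t ≤ 0, Real.smoothTransition t = 0 :=
    fun t ht => Real.smoothTransition.zero_of_nonpos ht
  have hP' := deriv_contDiff hP
  have h0' : ∀ t ≤ 0, deriv Real.smoothTransition t = 0 :=
    fun t ht => deriv_eq_zero_of_nonpos hP h0 ht
  -- Here `c - b * ‖x‖ ^ 2 = (225 - 256 * ‖x‖ ^ 2) / 29`, which is 1 at `‖x‖ = 14 / 16` and 0 at
  -- `‖x‖ = 15 / 16`. So the cutoff is 1 on `B_{7/8}` and 0 outside `B_{15/16}`.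
  set b : ℝ := 256 / 29 with hb
  set c : ℝ := 225 / 29 with hc
  have hb0 : 0 < b := by norm_num [hb]
  set χ : Euc n → ℝ := radialProfile Real.smoothTransition b c with hχ
  set g : Euc n → ℝ := radialProfile (deriv Real.smoothTransition) b c with hg
  have hχc : HasCompactSupport χ := radialProfile_hasCompactSupport hb0 h0
  have hχs : Continuous χ := (radialProfile_contDiff hP).continuous
  have hgc : HasCompactSupport g := radialProfile_hasCompactSupport hb0 h0'
  have hgs : Continuous g := (radialProfile_contDiff hP').continuous
  have hχ1 : ∀ x ∈ ball (0 : Euc n) (7 / 8), χ x = 1 := by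
    intro x hx
    have hx' : ‖x‖ < 7 / 8 := by simpa using hx
    refine Real.smoothTransition.one_of_one_le ?_
    rw [hb, hc]
    nlinarith [norm_nonneg x]
  have hχ0 : ∀ x, 0 ≤ χ x := fun x => Real.smoothTransition.nonneg _
  have hχz : ∀ x, x ∉ ball (0 : Euc n) (15 / 16) → χ x = 0 := fun x hx =>
    radialProfile_eq_zero hb0 h0 (by norm_num) (by norm_num [hb, hc]) (R := 15 / 16)
      (by simpa using hx)
  have hgz : ∀ x, x ∉ ball (0 : Euc n) (15 / 16) \ ball 0 (1 / 2) → g x = 0 := by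
    intro x hx
    by_cases h1 : x ∈ ball (0 : Euc n) (15 / 16)
    · have h2 : ‖x‖ < 1 / 2 := by
        by_contra h
        exact hx ⟨h1, by simpa using h⟩
      have h3 : 1 < c - b * ‖x‖ ^ 2 := by
        rw [hb, hc]
        nlinarith [norm_nonneg x]
      have : Real.smoothTransition =ᶠ[nhds (c - b * ‖x‖ ^ 2)] fun _ => 1 := by
        filter_upwards [Ioi_mem_nhds h3] with t ht
        exact Real.smoothTransition.one_of_one_le (le_of_lt ht)
      simpa [hg, radialProfile] using this.deriv_eq
    · exact radialProfile_eq_zero hb0 h0' (by norm_num) (by norm_num [hb, hc]) (R := 15 / 16)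
        (by simpa using h1)
  obtain ⟨M, hM⟩ := hgc.exists_bound_of_continuous hgs
  refine ⟨ENNReal.ofReal (2 * b * M), ENNReal.ofReal_ne_top, fun u hu hΔ => ?_⟩
  have hΔc := laplacian_continuous hu
  have ibp := integral_radialProfile_mul_laplacian (c := c) hP hb0 h0 hu 0 1
  simp only [one_mul, zero_add, one_smul] at ibp
  -- Superharmonicity enters here: the sign turns the integral of `|Δ u|` into a linear quantity
  -- that can be integrated by parts.
  have hnn : ∀ x, 0 ≤ -(χ x * Δ u x) := by
    intro x
    by_cases hx : x ∈ ball (0 : Euc n) (15 / 16)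
    · have := mul_nonneg (hχ0 x) (neg_nonneg.2 (hΔ x hx))
      linarith
    · simp [hχz x hx]
  have hint : Integrable fun x => -(χ x * Δ u x) :=
    ((hχs.mul hΔc).integrable_of_hasCompactSupport hχc.mul_right).neg
  calc ∫⁻ x in ball (0 : Euc n) (7 / 8), ‖Δ u x‖ₑ
      ≤ ∫⁻ x, ENNReal.ofReal (-(χ x * Δ u x)) := by
        rw [← lintegral_indicator measurableSet_ball]
        refine lintegral_mono fun x => ?_
        by_cases hx : x ∈ ball (0 : Euc n) (7 / 8)
        · rw [Set.indicator_of_mem hx, hχ1 x hx, one_mul, ← ofReal_norm, Real.norm_eq_abs,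
            abs_of_nonpos (hΔ x (ball_subset_ball (by norm_num) hx))]
        · simp [Set.indicator_of_notMem hx]
    _ = ENNReal.ofReal (∫ x, -(χ x * Δ u x)) :=
        (ofReal_integral_eq_lintegral_ofReal hint (Filter.Eventually.of_forall hnn)).symm
    _ ≤ ‖∫ x, 2 * b * g x * fderiv ℝ u x x‖ₑ := by
        rw [integral_neg, ibp, ← ofReal_norm, ← norm_neg]
        exact ENNReal.ofReal_le_ofReal (le_abs_self _)
    _ ≤ ∫⁻ x, ‖2 * b * g x * fderiv ℝ u x x‖ₑ := enorm_integral_le_lintegral_enorm _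
    _ ≤ ∫⁻ x in ball (0 : Euc n) (15 / 16) \ ball 0 (1 / 2),
          ENNReal.ofReal (2 * b * M) * ‖radialDeriv u x‖ₑ := by
        rw [← lintegral_indicator (measurableSet_ball.diff measurableSet_ball)]
        refine lintegral_mono fun x => ?_
        by_cases hx : x ∈ ball (0 : Euc n) (15 / 16) \ ball 0 (1 / 2)
        · rw [Set.indicator_of_mem hx, fderiv_apply_self, ← mul_assoc, enorm_mul]
          gcongr
          rw [← ofReal_norm]
          refine ENNReal.ofReal_le_ofReal ?_
          have h1 : ‖x‖ ≤ 1 := by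
            have := mem_ball_zero_iff.1 hx.1
            linarith
          rw [norm_mul, norm_mul, Real.norm_of_nonneg (by positivity : 0 ≤ 2 * b), norm_norm]
          calc 2 * b * ‖g x‖ * ‖x‖ ≤ 2 * b * ‖g x‖ * 1 := by gcongr
            _ ≤ 2 * b * M := by
              rw [mul_one]
              gcongr
              exact hM x
        · simp [hgz x hx]
    _ = _ := lintegral_const_mul' _ _ ENNReal.ofReal_ne_top

end RadialDeriv

/-! ### Compactness of averages, cutoff and maximum principle. -/

section Compactness

variable {n : ℕ}

/-- Arzelà–Ascoli for equi-Lipschitz, equibounded sequences. -/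
lemma exists_subseq_tendsto_of_lipschitz {w : ℕ → Euc n → ℝ} {M : ℝ} {L : ℝ≥0}
    (hM : ∀ k x, |w k x| ≤ M) (hL : ∀ k, LipschitzWith L (w k)) (R : ℝ) :
    ∃ W : Euc n → ℝ, Continuous W ∧ ∃ φ : ℕ → ℕ, StrictMono φ ∧
      ∀ x ∈ closedBall (0 : Euc n) R, Tendsto (fun k => w (φ k) x) atTop (𝓝 (W x)) := by
  have : CompactSpace (closedBall (0 : Euc n) R) :=
    isCompact_iff_compactSpace.1 (isCompact_closedBall 0 R)
  let f : ℕ → BoundedContinuousFunction (closedBall (0 : Euc n) R) ℝ := fun k =>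
    BoundedContinuousFunction.mkOfCompact ⟨fun x => w k x, (hL k).continuous.comp (by fun_prop)⟩
  have hcomp : IsCompact (closure (Set.range f)) := by
    refine BoundedContinuousFunction.arzela_ascoli (Set.Icc (-M) M) isCompact_Icc _ ?_ ?_
    · rintro _ x ⟨k, rfl⟩
      exact abs_le.1 (hM k x)
    · refine UniformEquicontinuous.equicontinuous ?_
      refine LipschitzWith.uniformEquicontinuous _ L ?_
      rintro ⟨_, k, rfl⟩
      exact (hL k).comp (LipschitzWith.subtype_val _) |>.weaken (by simp)
  obtain ⟨W₀, -, φ, hφ, hlim⟩ := hcomp.tendsto_subseq fun k => subset_closure (Set.mem_range_self k)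
  -- Tietze extension makes the limit continuous on the whole space; convergence is claimed only on
  -- the ball.
  obtain ⟨W, hW⟩ := ContinuousMap.exists_restrict_eq (isClosed_closedBall (x := (0 : Euc n)) (ε := R))
    W₀.toContinuousMap
  refine ⟨W, W.continuous, φ, hφ, fun x hx => ?_⟩
  have h1 : W x = W₀ ⟨x, hx⟩ := by
    have := DFunLike.congr_fun hW ⟨x, hx⟩
    simpa using this
  rw [h1]
  have h2 := (BoundedContinuousFunction.tendsto_iff_tendstoUniformly.1 hlim).tendsto_at ⟨x, hx⟩
  exact h2

lemma abs_integral_mul_le {K f : Euc n → ℝ} {M : ℝ} (hM0 : 0 ≤ M) (hM : ∀ x, |K x| ≤ M)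
    (hf : ∫⁻ x, ‖f x‖ₑ ≤ 1) : |∫ x, K x * f x| ≤ M := by
  have h : ‖∫ x, K x * f x‖ₑ ≤ ENNReal.ofReal M := by
    calc ‖∫ x, K x * f x‖ₑ ≤ ∫⁻ x, ‖K x * f x‖ₑ := enorm_integral_le_lintegral_enorm _
      _ ≤ ∫⁻ x, ENNReal.ofReal M * ‖f x‖ₑ := by
        refine lintegral_mono fun x => ?_
        rw [enorm_mul]
        gcongr
        rw [← ofReal_norm]
        exact ENNReal.ofReal_le_ofReal (hM x)
      _ = ENNReal.ofReal M * ∫⁻ x, ‖f x‖ₑ := lintegral_const_mul' _ _ ENNReal.ofReal_ne_top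
      _ ≤ ENNReal.ofReal M * 1 := by gcongr
      _ = _ := mul_one _
  rw [← ofReal_norm] at h
  exact (ENNReal.ofReal_le_ofReal_iff hM0).1 h

/-- Averages of functions in the unit ball of `L¹` against a fixed smooth kernel are equibounded and
equi-Lipschitz. -/
lemma exists_bound_lipschitz_average {K : Euc n → ℝ} (hK : ContDiff ℝ ∞ K)
    (hKc : HasCompactSupport K) :
    ∃ M : ℝ, ∃ L : ℝ≥0, (∀ y, |K y| ≤ M) ∧ ∀ f : Euc n → ℝ, Continuous f → HasCompactSupport f →
      ∫⁻ x, ‖f x‖ₑ ≤ 1 → (∀ x, |∫ y, K y * f (x + y)| ≤ M) ∧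
        LipschitzWith L fun x => ∫ y, K y * f (x + y) := by
  obtain ⟨M, hM⟩ := hKc.exists_bound_of_continuous hK.continuous
  obtain ⟨L, hL⟩ := hK.lipschitzWith_of_hasCompactSupport hKc (by simp)
  have hM0 : 0 ≤ M := (norm_nonneg _).trans (hM 0)
  refine ⟨M, L, hM, fun f hf hfc h1 => ?_⟩
  -- Moving the translation onto `K` lets the bounds depend only on the sup and Lipschitz constants
  -- of `K` and on the `L¹` norm of `f`.
  have htr : ∀ x, ∫ y, K y * f (x + y) = ∫ y, K (y - x) * f y := by
    intro x
    rw [← integral_add_left_eq_self (fun y => K (y - x) * f y) x]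
    simp
  simp_rw [htr]
  have hKcont := hK.continuous
  refine ⟨fun x => abs_integral_mul_le hM0 (fun y => hM _) h1, LipschitzWith.of_dist_le_mul ?_⟩
  intro x x'
  have hi : ∀ z, Integrable fun y => K (y - z) * f y := fun z =>
    Continuous.integrable_of_hasCompactSupport (by fun_prop) hfc.mul_left
  rw [Real.dist_eq, ← integral_sub (hi x) (hi x')]
  simp_rw [← sub_mul]
  refine abs_integral_mul_le (by positivity) (fun y => ?_) h1
  have := hL.dist_le_mul (y - x) (y - x')
  rw [Real.dist_eq] at this
  refine this.trans (le_of_eq ?_)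
  rw [dist_sub_left]

/-- A smooth function on the closed unit ball has a compactly supported modification near the
boundary. -/
lemma exists_contDiff_cutoff {u : Euc n → ℝ} (hu : ContDiffOn ℝ ∞ u (closedBall 0 1)) :
    ∃ v : Euc n → ℝ, ContDiff ℝ ∞ v ∧ HasCompactSupport v ∧
      (∀ x ∈ ball (0 : Euc n) (31 / 32), v x = u x) ∧
      ∫⁻ x, ‖v x‖ₑ ≤ ∫⁻ x in ball (0 : Euc n) 1, ‖u x‖ₑ := by
  let η : ContDiffBump (0 : Euc n) := ⟨31 / 32, 63 / 64, by norm_num, by norm_num⟩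
  have hη : ∀ x, x ∉ ball (0 : Euc n) (63 / 64) → η x = 0 := fun x hx =>
    η.zero_of_le_dist (by simpa [η] using hx)
  refine ⟨fun x => η x * u x, ?_, η.hasCompactSupport.mul_right, ?_, ?_⟩
  · rw [contDiff_iff_contDiffAt]
    intro x
    by_cases hx : x ∈ ball (0 : Euc n) 1
    · exact η.contDiffAt.mul (hu.contDiffAt (mem_of_superset (isOpen_ball.mem_nhds hx)
        ball_subset_closedBall))
    · have hx' : x ∈ (closedBall (0 : Euc n) (63 / 64))ᶜ := fun h =>
        hx (closedBall_subset_ball (by norm_num) h)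
      have : (fun x => η x * u x) =ᶠ[𝓝 x] fun _ => 0 := by
        filter_upwards [isClosed_closedBall.isOpen_compl.mem_nhds hx'] with y hy
        rw [hη y fun h => hy (ball_subset_closedBall h), zero_mul]
      exact contDiffAt_const.congr_of_eventuallyEq this
  · intro x hx
    beta_reduce
    rw [η.one_of_mem_closedBall (ball_subset_closedBall hx), one_mul]
  · rw [← lintegral_indicator measurableSet_ball]
    refine lintegral_mono fun x => ?_
    by_cases hx : x ∈ ball (0 : Euc n) 1
    · rw [Set.indicator_of_mem hx, enorm_mul]
      refine mul_le_of_le_one_left' ?_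
      rw [← ofReal_norm, Real.norm_of_nonneg η.nonneg]
      exact ENNReal.ofReal_le_one.2 η.le_one
    · beta_reduce
      rw [hη x fun h => hx (ball_subset_ball (by norm_num) h)]
      simp

/-- A maximum principle: a function with a local mean value property, invariant under dilations in
an annulus, attains its maximum at the origin. -/
lemma le_apply_zero_of_mean_value {K w : Euc n → ℝ} (hK : Continuous K)
    (hKc : HasCompactSupport K) (hK0 : ∀ y, 0 ≤ K y) (hKp : ∀ y, ‖y‖ < 1 / 16 → 0 < K y)
    (hKz : ∀ y, 1 / 16 ≤ ‖y‖ → K y = 0) (hK1 : ∫ y, K y = 1) (hw : Continuous w)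
    (hmean : ∀ x, ‖x‖ ≤ 1 / 2 → ∫ y, K y * w (x + y) = w x)
    (hdil : ∀ s : ℝ, 0 < s → s < 1 → ∀ x, 1 / 2 < s * ‖x‖ → ‖x‖ ≤ 3 / 4 → w x = w (s • x))
    {x : Euc n} (hx : ‖x‖ ≤ 3 / 4) : w x ≤ w 0 := by
  obtain ⟨x₁, hx₁, hmax⟩ := (isCompact_closedBall (0 : Euc n) (3 / 4)).exists_isMaxOn
    ⟨0, by simp; norm_num⟩ hw.continuousOn
  have hmax' : ∀ y, ‖y‖ ≤ 3 / 4 → w y ≤ w x₁ := fun y hy => hmax (by simpa using hy)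
  have hScomp : IsCompact (closedBall (0 : Euc n) (3 / 4) ∩ w ⁻¹' {w x₁}) :=
    (isCompact_closedBall _ _).inter_right (isClosed_singleton.preimage hw)
  -- Among the maximum points take one closest to the origin. If it is not the origin, a maximum
  -- point still closer is produced: by a dilation when `‖x₀‖ > 1 / 2`, by the mean value property
  -- otherwise.
  obtain ⟨x₀, ⟨hx₀, hwx₀⟩, hmin⟩ := hScomp.exists_isMinOn ⟨x₁, hx₁, rfl⟩
    continuous_norm.continuousOn
  have hx₀' : ‖x₀‖ ≤ 3 / 4 := by simpa using hx₀
  have hwx₀' : w x₀ = w x₁ := hwx₀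
  have hmin' : ∀ y, ‖y‖ ≤ 3 / 4 → w y = w x₁ → ‖x₀‖ ≤ ‖y‖ := fun y hy h =>
    hmin (show y ∈ _ from ⟨by simpa using hy, h⟩)
  suffices h : x₀ = 0 by
    rw [← h, hwx₀']
    exact hmax' x hx
  by_contra hne
  have hpos : 0 < ‖x₀‖ := norm_pos_iff.2 hne
  rcases lt_or_ge (1 / 2) ‖x₀‖ with hgt | hle
  · obtain ⟨s, hs1, hs2⟩ := exists_between (show 1 / 2 / ‖x₀‖ < 1 by rwa [div_lt_one hpos])
    have hs0 : 0 < s := lt_trans (by positivity) hs1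
    have hs3 : 1 / 2 < s * ‖x₀‖ := by rwa [div_lt_iff₀ hpos] at hs1
    have hn : ‖s • x₀‖ = s * ‖x₀‖ := by rw [norm_smul, Real.norm_of_nonneg hs0.le]
    have := hmin' (s • x₀) (by rw [hn]; nlinarith)
      (by rw [← hdil s hs0 hs2 x₀ hs3 hx₀', hwx₀'])
    rw [hn] at this
    nlinarith
  · set F : Euc n → ℝ := fun y => K y * (w x₀ - w (x₀ + y)) with hF
    have hFc : Continuous F := by fun_prop
    have hFcs : HasCompactSupport F := hKc.mul_right
    have hball : ∀ y : Euc n, ‖y‖ < 1 / 16 → ‖x₀ + y‖ ≤ 3 / 4 := fun y hy => by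
      have := norm_add_le x₀ y
      linarith
    have hF0 : ∀ y, 0 ≤ F y := by
      intro y
      rcases lt_or_ge ‖y‖ (1 / 16) with hy | hy
      · refine mul_nonneg (hK0 y) (sub_nonneg.2 ?_)
        rw [hwx₀']
        exact hmax' _ (hball y hy)
      · simp [hF, hKz y hy]
    have hFi : ∫ y, F y = 0 := by
      have h1 : Integrable fun y => K y * w x₀ :=
        (hK.integrable_of_hasCompactSupport hKc).mul_const _
      have h2 : Integrable fun y => K y * w (x₀ + y) :=
        Continuous.integrable_of_hasCompactSupport (by fun_prop) hKc.mul_right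
      simp_rw [hF, mul_sub]
      rw [integral_sub h1 h2, integral_mul_const, hK1, hmean x₀ hle]
      ring
    -- A continuous nonnegative function with zero integral vanishes, so `w` equals its maximum
    -- wherever the kernel is positive, in particular at `(1 - t) • x₀`.
    have hFz : ∀ y, F y = 0 := by
      intro y
      by_contra hy
      exact (hFc.integral_pos_of_hasCompactSupport_nonneg_nonzero hFcs hF0 hy).ne' hFi
    obtain ⟨t, ht0, ht1⟩ := exists_between (show (0 : ℝ) < min 1 (1 / 16) by norm_num)
    have ht1' : t < 1 / 16 := ht1.trans_le (min_le_right _ _)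
    set y : Euc n := (-t) • x₀ with hy
    have hyn : ‖y‖ < 1 / 16 := by
      rw [hy, norm_smul, norm_neg, Real.norm_of_nonneg ht0.le]
      nlinarith
    have hwy : w (x₀ + y) = w x₁ := by
      have := hFz y
      simp only [hF, mul_eq_zero, (hKp y hyn).ne', false_or] at this
      linarith
    have hle2 := hmin' _ (hball y hyn) hwy
    have : x₀ + y = (1 - t) • x₀ := by rw [hy, sub_smul, one_smul, neg_smul, sub_eq_add_neg]
    rw [this, norm_smul, Real.norm_of_nonneg (by linarith)] at hle2
    nlinarith

end Compactness

/-! ### Passing to the limit along a subsequence. -/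

section Limit

variable {n : ℕ}

lemma tendsto_zero_of_le_add {a b c : ℕ → ℝ≥0∞} (hb : Tendsto b atTop (𝓝 0))
    (hc : Tendsto c atTop (𝓝 0)) (h : ∀ k, a k ≤ b k + c k) : Tendsto a atTop (𝓝 0) := by
  have := hb.add hc
  rw [add_zero] at this
  exact tendsto_of_tendsto_of_tendsto_of_le_of_le tendsto_const_nhds this (fun _ => zero_le) h

lemma tendsto_zero_of_le_mul {a b : ℕ → ℝ≥0∞} {C : ℝ≥0∞} (hC : C ≠ ⊤)
    (hb : Tendsto b atTop (𝓝 0)) (h : ∀ k, a k ≤ C * b k) : Tendsto a atTop (𝓝 0) := by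
  have := ENNReal.Tendsto.const_mul hb (Or.inr hC)
  rw [mul_zero] at this
  exact tendsto_of_tendsto_of_tendsto_of_le_of_le tendsto_const_nhds this (fun _ => zero_le) h

/-- A bounded sequence in `L¹` with Laplacians tending to zero has a subsequence converging to
a continuous function with a mean value property. -/
lemma exists_subseq_tendsto_mean_value {K : Euc n → ℝ} (hK : ContDiff ℝ ∞ K)
    (hKc : HasCompactSupport K) (hKz : ∀ y, 1 / 16 ≤ ‖y‖ → K y = 0)
    {C : ℝ≥0∞} (hC : C ≠ ⊤) (hKΔ : ∀ u : Euc n → ℝ, ContDiff ℝ 2 u → ∀ a : ℝ,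
        ∫⁻ x in ball (0 : Euc n) a, ‖u x - ∫ y, K y * u (x + y)‖ₑ ≤
          C * ∫⁻ x in ball (0 : Euc n) (a + 1 / 16), ‖Δ u x‖ₑ)
    {f : ℕ → Euc n → ℝ} (hf : ∀ k, ContDiff ℝ ∞ (f k)) (hfc : ∀ k, HasCompactSupport (f k))
    (h1 : ∀ k, ∫⁻ x, ‖f k x‖ₑ ≤ 1)
    (hΔ : Tendsto (fun k => ∫⁻ x in ball (0 : Euc n) (7 / 8), ‖Δ (f k) x‖ₑ) atTop (𝓝 0)) :
    ∃ w : Euc n → ℝ, Continuous w ∧ ∃ φ : ℕ → ℕ, StrictMono φ ∧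
      Tendsto (fun k => ∫⁻ x in ball (0 : Euc n) (13 / 16), ‖f (φ k) x - w x‖ₑ) atTop (𝓝 0) ∧
      ∀ x, ‖x‖ ≤ 3 / 4 → ∫ y, K y * w (x + y) = w x := by
  obtain ⟨M, L, hM, hML⟩ := exists_bound_lipschitz_average hK hKc
  have hKcont := hK.continuous
  have hA := fun k => hML (f k) (hf k).continuous (hfc k) (h1 k)
  obtain ⟨w, hw, φ, hφ, hlim⟩ := exists_subseq_tendsto_of_lipschitz (fun k => (hA k).1)
    (fun k => (hA k).2) (13 / 16)
  have hφt := hφ.tendsto_atTop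
  have hwM : ∀ x ∈ closedBall (0 : Euc n) (13 / 16), |w x| ≤ M := fun x hx =>
    le_of_tendsto (hlim x hx).abs (Eventually.of_forall fun k => (hA (φ k)).1 x)
  -- The radii shrink by the kernel radius: `7 / 8 = 13 / 16 + 1 / 16` here, and `13 / 16 = 3 / 4 +
  -- 1 / 16` for the mean value property of the limit.
  have hT1 : Tendsto (fun k => ∫⁻ x in ball (0 : Euc n) (13 / 16),
      ‖f (φ k) x - ∫ y, K y * f (φ k) (x + y)‖ₑ) atTop (𝓝 0) := by
    refine tendsto_zero_of_le_mul hC (hΔ.comp hφt) fun k => ?_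
    have := hKΔ (f (φ k)) (by exact_mod_cast contDiff_infty.1 (hf (φ k)) 2) (13 / 16)
    norm_num at this ⊢
    exact this
  have hT2 : Tendsto (fun k => ∫⁻ x in ball (0 : Euc n) (13 / 16),
      ‖(∫ y, K y * f (φ k) (x + y)) - w x‖ₑ) atTop (𝓝 0) := by
    have : (0 : ℝ≥0∞) = ∫⁻ x in ball (0 : Euc n) (13 / 16), 0 := by simp
    rw [this]
    refine tendsto_lintegral_of_dominated_convergence (fun _ => ENNReal.ofReal (2 * M)) ?_ ?_ ?_ ?_
    · intro k
      exact ((hA (φ k)).2.continuous.sub hw).measurable.enorm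
    · intro k
      filter_upwards [ae_restrict_mem measurableSet_ball] with x hx
      rw [← ofReal_norm]
      refine ENNReal.ofReal_le_ofReal ((norm_sub_le _ _).trans ?_)
      have h2 := hwM x (ball_subset_closedBall hx)
      have h3 := (hA (φ k)).1 x
      rw [Real.norm_eq_abs, Real.norm_eq_abs]
      linarith
    · rw [setLIntegral_const]
      exact ENNReal.mul_ne_top ENNReal.ofReal_ne_top measure_ball_lt_top.ne
    · filter_upwards [ae_restrict_mem measurableSet_ball] with x hx
      have := (hlim x (ball_subset_closedBall hx)).sub_const (w x)
      rw [sub_self] at this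
      simpa using this.enorm
  have hT : Tendsto (fun k => ∫⁻ x in ball (0 : Euc n) (13 / 16), ‖f (φ k) x - w x‖ₑ)
      atTop (𝓝 0) := by
    refine tendsto_zero_of_le_add hT1 hT2 fun k => ?_
    have hm : Measurable fun x => ‖(∫ y, K y * f (φ k) (x + y)) - w x‖ₑ :=
      ((hA (φ k)).2.continuous.sub hw).measurable.enorm
    rw [← lintegral_add_right _ hm]
    refine lintegral_mono fun x => ?_
    refine le_trans (le_of_eq ?_) (enorm_add_le _ _)
    congr 1
    ring
  refine ⟨w, hw, φ, hφ, hT, fun x hx => ?_⟩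
  have hlim1 := hlim x (by simpa using hx.trans (by norm_num))
  refine tendsto_nhds_unique ?_ hlim1
  have hz : Tendsto (fun k => ‖(∫ y, K y * f (φ k) (x + y)) - ∫ y, K y * w (x + y)‖ₑ)
      atTop (𝓝 0) := by
    refine tendsto_zero_of_le_mul (C := ENNReal.ofReal M) ENNReal.ofReal_ne_top hT fun k => ?_
    have hfk := (hf (φ k)).continuous
    have hi1 : Integrable fun y => K y * f (φ k) (x + y) :=
      Continuous.integrable_of_hasCompactSupport (by fun_prop) hKc.mul_right
    have hi2 : Integrable fun y => K y * w (x + y) :=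
      Continuous.integrable_of_hasCompactSupport (by fun_prop) hKc.mul_right
    rw [← integral_sub hi1 hi2]
    simp_rw [← mul_sub]
    refine (enorm_integral_le_lintegral_enorm _).trans ?_
    rw [← lintegral_const_mul' _ _ ENNReal.ofReal_ne_top, ← lintegral_indicator measurableSet_ball,
      ← lintegral_add_left_eq_self
        ((ball (0 : Euc n) (13 / 16)).indicator fun z => ENNReal.ofReal M * ‖f (φ k) z - w z‖ₑ) x]
    refine lintegral_mono fun y => ?_
    rcases lt_or_ge ‖y‖ (1 / 16) with hy | hy
    · have : x + y ∈ ball (0 : Euc n) (13 / 16) := by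
        rw [mem_ball_zero_iff]
        have := norm_add_le x y
        linarith
      rw [Set.indicator_of_mem this, enorm_mul]
      gcongr
      rw [← ofReal_norm]
      exact ENNReal.ofReal_le_ofReal (hM y)
    · simp [hKz y hy]
  rw [tendsto_iff_edist_tendsto_0]
  simpa [edist_eq_enorm_sub] using hz

/-- An `L¹` limit of functions which are asymptotically invariant under dilations is invariant. -/
lemma eq_dilation_of_tendsto {f : ℕ → Euc n → ℝ} (hf : ∀ k, Continuous (f k)) {w : Euc n → ℝ}
    (hw : Continuous w) {s : ℝ} (hs0 : 0 < s) (hs1 : s < 1)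
    (hT : Tendsto (fun k => ∫⁻ x in ball (0 : Euc n) (13 / 16), ‖f k x - w x‖ₑ) atTop (𝓝 0))
    (hdil : Tendsto (fun k => ∫⁻ x in ball (0 : Euc n) (13 / 16) \ ball 0 (1 / (2 * s)),
      ‖f k x - f k (s • x)‖ₑ) atTop (𝓝 0))
    {x : Euc n} (hx : 1 / 2 < s * ‖x‖) (hx' : ‖x‖ ≤ 3 / 4) : w x = w (s • x) := by
  -- Removing a closed ball keeps `U` open, so almost everywhere equality of continuous functions
  -- upgrades to equality at every point of `U`.
  set U : Set (Euc n) := ball (0 : Euc n) (13 / 16) \ closedBall 0 (1 / (2 * s)) with hU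
  have hUo : IsOpen U := isOpen_ball.sdiff isClosed_closedBall
  have hws : Continuous fun x => w (s • x) := by fun_prop
  have hzero : ∫⁻ x in U, ‖w x - w (s • x)‖ₑ = 0 := by
    have hle : ∀ k, ∫⁻ x in U, ‖w x - w (s • x)‖ₑ ≤
        (∫⁻ x in ball (0 : Euc n) (13 / 16), ‖f k x - w x‖ₑ) +
        ((∫⁻ x in ball (0 : Euc n) (13 / 16) \ ball 0 (1 / (2 * s)), ‖f k x - f k (s • x)‖ₑ) +
        ENNReal.ofReal (s ^ n)⁻¹ * ∫⁻ x in ball (0 : Euc n) (13 / 16), ‖f k x - w x‖ₑ) := by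
      intro k
      have hfk := hf k
      have hm1 : Measurable fun x => ‖f k x - w x‖ₑ := (hfk.sub hw).measurable.enorm
      calc ∫⁻ x in U, ‖w x - w (s • x)‖ₑ
          ≤ ∫⁻ x in U, (‖f k x - w x‖ₑ + (‖f k x - f k (s • x)‖ₑ + ‖f k (s • x) - w (s • x)‖ₑ)) := by
            refine lintegral_mono fun x => ?_
            have : w x - w (s • x) = -(f k x - w x) +
              ((f k x - f k (s • x)) + (f k (s • x) - w (s • x))) := by ring
            rw [this]
            refine (enorm_add_le _ _).trans ?_
            rw [enorm_neg]
            gcongr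
            exact enorm_add_le _ _
        _ = (∫⁻ x in U, ‖f k x - w x‖ₑ) + ((∫⁻ x in U, ‖f k x - f k (s • x)‖ₑ) +
              ∫⁻ x in U, ‖f k (s • x) - w (s • x)‖ₑ) := by
            rw [lintegral_add_left hm1, lintegral_add_left]
            exact (Continuous.measurable (by fun_prop)).enorm
        _ ≤ _ := by
            gcongr ?_ + (?_ + ?_)
            · exact lintegral_mono_set Set.sdiff_subset
            · exact lintegral_mono_set (Set.sdiff_subset_sdiff_right ball_subset_closedBall)
            · refine lintegral_comp_smul_le hm1 measurableSet_ball hUo.measurableSet hs0 ?_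
              intro x hx
              have h1 : ‖x‖ < 13 / 16 := by simpa using hx.1
              rw [mem_ball_zero_iff, norm_smul, Real.norm_of_nonneg hs0.le]
              nlinarith [norm_nonneg x]
    have hz := tendsto_zero_of_le_add hT (tendsto_zero_of_le_add hdil
      (tendsto_zero_of_le_mul ENNReal.ofReal_ne_top hT fun _ => le_rfl) fun _ => le_rfl) hle
    exact tendsto_nhds_unique tendsto_const_nhds hz
  have hm : Measurable fun x => ‖w x - w (s • x)‖ₑ := (hw.sub hws).measurable.enorm
  rw [lintegral_eq_zero_iff hm] at hzero
  have hae : w =ᵐ[volume.restrict U] fun x => w (s • x) := by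
    filter_upwards [hzero] with x hx
    exact sub_eq_zero.1 (by simpa using hx)
  refine Measure.eqOn_open_of_ae_eq hae hUo hw.continuousOn hws.continuousOn ⟨?_, ?_⟩
  · rw [mem_ball_zero_iff]
    linarith
  · rw [mem_closedBall_zero_iff, not_le, div_lt_iff₀ (by positivity)]
    linarith

/-- Bounded sequences in `L¹` which are asymptotically harmonic and asymptotically invariant under
dilations have a subsequence converging to a constant. -/
lemma exists_subseq_tendsto_const {f : ℕ → Euc n → ℝ} (hf : ∀ k, ContDiff ℝ ∞ (f k))
    (hfc : ∀ k, HasCompactSupport (f k)) (h1 : ∀ k, ∫⁻ x, ‖f k x‖ₑ ≤ 1)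
    (hΔ : Tendsto (fun k => ∫⁻ x in ball (0 : Euc n) (7 / 8), ‖Δ (f k) x‖ₑ) atTop (𝓝 0))
    (hdil : ∀ s : ℝ, 0 < s → s < 1 → Tendsto (fun k =>
      ∫⁻ x in ball (0 : Euc n) (13 / 16) \ ball 0 (1 / (2 * s)), ‖f k x - f k (s • x)‖ₑ)
      atTop (𝓝 0)) :
    ∃ c : ℝ, ∃ φ : ℕ → ℕ, StrictMono φ ∧
      Tendsto (fun k => ∫⁻ x in ball (0 : Euc n) (3 / 4), ‖f (φ k) x - c‖ₑ) atTop (𝓝 0) := by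
  obtain ⟨K, hK, hKc, hK0, hKp, hKz, hK1, C, hC, hKΔ⟩ := exists_averaging_kernel (n := n)
  obtain ⟨w, hw, φ, hφ, hT, hmean⟩ :=
    exists_subseq_tendsto_mean_value hK hKc hKz hC hKΔ hf hfc h1 hΔ
  have hwdil : ∀ s : ℝ, 0 < s → s < 1 → ∀ x, 1 / 2 < s * ‖x‖ → ‖x‖ ≤ 3 / 4 → w x = w (s • x) :=
    fun s hs0 hs1 x hx hx' => eq_dilation_of_tendsto (fun k => (hf (φ k)).continuous) hw hs0 hs1 hT
      ((hdil s hs0 hs1).comp hφ.tendsto_atTop) hx hx'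
  have hconst : ∀ x : Euc n, ‖x‖ ≤ 3 / 4 → w x = w 0 := by
    intro x hx
    refine le_antisymm (le_apply_zero_of_mean_value hK.continuous hKc hK0 hKp hKz hK1 hw
      (fun x hx => hmean x (hx.trans (by norm_num))) hwdil hx) ?_
    have := le_apply_zero_of_mean_value (w := fun x => -w x) hK.continuous hKc hK0 hKp hKz hK1
      hw.neg (fun x hx => by
        simp_rw [mul_neg]
        rw [integral_neg, hmean x (hx.trans (by norm_num))])
      (fun s hs0 hs1 x hx hx' => by rw [hwdil s hs0 hs1 x hx hx']) hx
    linarith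
  refine ⟨w 0, φ, hφ, ?_⟩
  refine tendsto_of_tendsto_of_tendsto_of_le_of_le tendsto_const_nhds hT (fun _ => zero_le) ?_
  intro k
  calc ∫⁻ x in ball (0 : Euc n) (3 / 4), ‖f (φ k) x - w 0‖ₑ
      = ∫⁻ x in ball (0 : Euc n) (3 / 4), ‖f (φ k) x - w x‖ₑ := by
        refine setLIntegral_congr_fun measurableSet_ball fun x hx => ?_
        have hx' : ‖x‖ < 3 / 4 := by simpa using hx
        simp only [hconst x hx'.le]
    _ ≤ _ := lintegral_mono_set (ball_subset_ball (by norm_num))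

/-- Superharmonic functions, bounded in `L¹`, whose radial derivatives tend to zero in an annulus
have a subsequence converging to a constant. -/
lemma exists_subseq_superharmonic_tendsto_const {v : ℕ → Euc n → ℝ}
    (hv : ∀ k, ContDiffOn ℝ ∞ (v k) (closedBall 0 1))
    (hsup : ∀ k, ∀ x ∈ ball (0 : Euc n) 1, Δ (v k) x ≤ 0)
    (h1 : ∀ k, ∫⁻ x in ball (0 : Euc n) 1, ‖v k x‖ₑ ≤ 1)
    (hrd : Tendsto (fun k => ∫⁻ x in ball (0 : Euc n) 1 \ ball 0 (1 / 2), ‖radialDeriv (v k) x‖ₑ)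
      atTop (𝓝 0)) :
    ∃ c : ℝ, ∃ φ : ℕ → ℕ, StrictMono φ ∧
      Tendsto (fun k => ∫⁻ x in ball (0 : Euc n) 1, ‖v (φ k) x - c‖ₑ) atTop (𝓝 0) := by
  choose f hf hfc hfv hf1 using fun k => exists_contDiff_cutoff (hv k)
  have hev : ∀ k, ∀ x ∈ ball (0 : Euc n) (31 / 32), f k =ᶠ[𝓝 x] v k := fun k x hx => by
    filter_upwards [isOpen_ball.mem_nhds hx] with y hy using hfv k y hy
  have hv1 : ∀ k, ContDiffOn ℝ 1 (v k) (ball 0 1) := fun k =>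
    ((hv k).mono ball_subset_closedBall).of_le (by exact_mod_cast le_top)
  have hdilv : ∀ s : ℝ, 0 < s → s < 1 → Tendsto (fun k =>
      ∫⁻ x in ball (0 : Euc n) 1 \ ball 0 (1 / (2 * s)), ‖v k x - v k (s • x)‖ₑ)
      atTop (𝓝 0) := fun s hs0 hs1 =>
    tendsto_zero_of_le_mul ENNReal.ofReal_ne_top hrd
      fun k => lintegral_sub_dilation_le (hv1 k) hs0 hs1.le
  have hdil : ∀ s : ℝ, 0 < s → s < 1 → Tendsto (fun k =>
      ∫⁻ x in ball (0 : Euc n) (13 / 16) \ ball 0 (1 / (2 * s)), ‖f k x - f k (s • x)‖ₑ)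
      atTop (𝓝 0) := by
    intro s hs0 hs1
    refine tendsto_of_tendsto_of_tendsto_of_le_of_le tendsto_const_nhds (hdilv s hs0 hs1)
      (fun _ => zero_le) fun k => ?_
    calc ∫⁻ x in ball (0 : Euc n) (13 / 16) \ ball 0 (1 / (2 * s)), ‖f k x - f k (s • x)‖ₑ
        = ∫⁻ x in ball (0 : Euc n) (13 / 16) \ ball 0 (1 / (2 * s)), ‖v k x - v k (s • x)‖ₑ := by
          refine setLIntegral_congr_fun (measurableSet_ball.diff measurableSet_ball) fun x hx => ?_
          have hx' : ‖x‖ < 13 / 16 := by simpa using hx.1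
          beta_reduce
          rw [hfv k x (by rw [mem_ball_zero_iff]; linarith), hfv k (s • x) (by
            rw [mem_ball_zero_iff, norm_smul, Real.norm_of_nonneg hs0.le]
            nlinarith [norm_nonneg x])]
      _ ≤ _ := lintegral_mono_set (Set.sdiff_subset_sdiff_left (ball_subset_ball (by norm_num)))
  have hΔ : Tendsto (fun k => ∫⁻ x in ball (0 : Euc n) (7 / 8), ‖Δ (f k) x‖ₑ) atTop (𝓝 0) := by
    obtain ⟨C, hC, hCu⟩ := exists_lintegral_laplacian_le (n := n)
    refine tendsto_zero_of_le_mul hC hrd fun k => ?_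
    refine (hCu (f k) (by exact_mod_cast contDiff_infty.1 (hf k) 2) ?_).trans ?_
    · intro x hx
      rw [(InnerProductSpace.laplacian_congr_nhds
        (hev k x (ball_subset_ball (by norm_num) hx))).eq_of_nhds]
      exact hsup k x (ball_subset_ball (by norm_num) hx)
    · refine mul_le_mul_right ?_ C
      calc ∫⁻ x in ball (0 : Euc n) (15 / 16) \ ball 0 (1 / 2), ‖radialDeriv (f k) x‖ₑ
          = ∫⁻ x in ball (0 : Euc n) (15 / 16) \ ball 0 (1 / 2), ‖radialDeriv (v k) x‖ₑ := by
            refine setLIntegral_congr_fun (measurableSet_ball.diff measurableSet_ball)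
              fun x hx => ?_
            rw [radialDeriv_congr (hev k x (ball_subset_ball (by norm_num) hx.1))]
        _ ≤ _ := lintegral_mono_set (Set.sdiff_subset_sdiff_left (ball_subset_ball (by norm_num)))
  obtain ⟨c, φ, hφ, hT⟩ := exists_subseq_tendsto_const hf hfc (fun k => (hf1 k).trans (h1 k))
    hΔ hdil
  refine ⟨c, φ, hφ, ?_⟩
  -- Dilation by `s = 2 / 3` sends `B_1` into `B_{3/4}`, where convergence is known, and `1 / (2 *
  -- s) = 3 / 4` is exactly the inner radius of the remaining shell.
  have hout : Tendsto (fun k => ∫⁻ x in ball (0 : Euc n) 1 \ ball 0 (3 / 4), ‖v (φ k) x - c‖ₑ)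
      atTop (𝓝 0) := by
    refine tendsto_zero_of_le_add ((hdilv (2 / 3) (by norm_num) (by norm_num)).comp hφ.tendsto_atTop)
      (tendsto_zero_of_le_mul (C := ENNReal.ofReal ((2 / 3) ^ n)⁻¹) ENNReal.ofReal_ne_top hT
        fun _ => le_rfl) fun k => ?_
    have hfk := (hf (φ k)).continuous
    have hm : Measurable fun x => ‖f (φ k) x - c‖ₑ := (hfk.sub continuous_const).measurable.enorm
    have hmem : ∀ x ∈ ball (0 : Euc n) 1 \ ball 0 (3 / 4),
        (2 / 3 : ℝ) • x ∈ ball (0 : Euc n) (3 / 4) := by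
      intro x hx
      have hx' : ‖x‖ < 1 := by simpa using hx.1
      rw [mem_ball_zero_iff, norm_smul, Real.norm_of_nonneg (by norm_num)]
      linarith
    have hR : (1 : ℝ) / (2 * (2 / 3)) = 3 / 4 := by norm_num
    simp only [Function.comp_apply, hR]
    calc ∫⁻ x in ball (0 : Euc n) 1 \ ball 0 (3 / 4), ‖v (φ k) x - c‖ₑ
        ≤ ∫⁻ x in ball (0 : Euc n) 1 \ ball 0 (3 / 4),
          (‖v (φ k) x - v (φ k) ((2 / 3 : ℝ) • x)‖ₑ + ‖f (φ k) ((2 / 3 : ℝ) • x) - c‖ₑ) := by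
          refine setLIntegral_mono' (measurableSet_ball.diff measurableSet_ball) fun x hx => ?_
          rw [hfv (φ k) _ (ball_subset_ball (by norm_num) (hmem x hx))]
          refine le_trans (le_of_eq ?_) (enorm_add_le _ _)
          congr 1
          ring
      _ = _ := lintegral_add_right _ (hm.comp (measurable_const_smul (2 / 3 : ℝ)))
      _ ≤ _ := by
          gcongr
          exact lintegral_comp_smul_le hm measurableSet_ball
            (measurableSet_ball.diff measurableSet_ball) (by norm_num) hmem
  refine tendsto_zero_of_le_add hT hout fun k => ?_
  calc ∫⁻ x in ball (0 : Euc n) 1, ‖v (φ k) x - c‖ₑ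
      ≤ ∫⁻ x in ball (0 : Euc n) (3 / 4) ∪ ball 0 1 \ ball 0 (3 / 4), ‖v (φ k) x - c‖ₑ :=
        lintegral_mono_set (by rw [Set.union_sdiff_self]; exact Set.subset_union_right)
    _ ≤ (∫⁻ x in ball (0 : Euc n) (3 / 4), ‖v (φ k) x - c‖ₑ) +
        ∫⁻ x in ball 0 1 \ ball 0 (3 / 4), ‖v (φ k) x - c‖ₑ := lintegral_union_le _ _ _
    _ = _ := by
        congr 1
        refine setLIntegral_congr_fun measurableSet_ball fun x hx => ?_
        rw [hfv (φ k) x (ball_subset_ball (by norm_num) hx)]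

end Limit

/-! ### Normalization and the contradiction. -/

section Normalization

variable {n : ℕ}

lemma fderiv_const_mul_sub_const (u : Euc n → ℝ) (a t : ℝ) :
    fderiv ℝ (fun x => a * (u x - t)) = a • fderiv ℝ u := by
  have h : (fun x => a * (u x - t)) = a • fun x => u x - t := by
    ext x
    simp
  rw [h, fderiv_const_smul_field]
  ext x
  simp [fderiv_sub_const]

lemma laplacian_const_mul_sub_const (u : Euc n → ℝ) (a t : ℝ) (x : Euc n) :
    Δ (fun x => a * (u x - t)) x = a * Δ u x := by
  have h : fderiv ℝ (a • fderiv ℝ u) = a • fderiv ℝ (fderiv ℝ u) :=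
    fderiv_const_smul_field (𝕜 := ℝ) (R := ℝ) (F := Euc n →L[ℝ] ℝ) (f := fderiv ℝ u) a
  rw [laplacian_eq_sum, laplacian_eq_sum, fderiv_const_mul_sub_const, h]
  simp [Finset.mul_sum]

lemma radialDeriv_const_mul_sub_const (u : Euc n → ℝ) (a t : ℝ) (x : Euc n) :
    radialDeriv (fun x => a * (u x - t)) x = a * radialDeriv u x := by
  unfold radialDeriv gradient
  rw [fderiv_const_mul_sub_const]
  simp [inner_smul_right]

/-- A mean-zero function is at most twice as far from zero as from any constant. -/
lemma lintegral_enorm_le_two_mul_of_integral_eq_zero {v : Euc n → ℝ} {B : Set (Euc n)}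
    (hB : volume B ≠ ⊤) (hv : IntegrableOn v B) (h0 : ∫ x in B, v x = 0) (c : ℝ) :
    ∫⁻ x in B, ‖v x‖ₑ ≤ 2 * ∫⁻ x in B, ‖v x - c‖ₑ := by
  have hc : ‖c‖ₑ * volume B ≤ ∫⁻ x in B, ‖v x - c‖ₑ := by
    have h1 : ∫ x in B, (v x - c) = -(volume.real B * c) := by
      rw [integral_sub hv (integrableOn_const hB), h0]
      simp
    have h2 := enorm_integral_le_lintegral_enorm (μ := volume.restrict B) fun x => v x - c
    rw [h1, enorm_neg, enorm_mul] at h2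
    rwa [Measure.real, Real.enorm_of_nonneg ENNReal.toReal_nonneg, ENNReal.ofReal_toReal hB,
      mul_comm] at h2
  calc ∫⁻ x in B, ‖v x‖ₑ ≤ ∫⁻ x in B, (‖v x - c‖ₑ + ‖c‖ₑ) := by
        refine lintegral_mono fun x => ?_
        refine le_trans (le_of_eq ?_) (enorm_add_le _ _)
        simp
    _ = (∫⁻ x in B, ‖v x - c‖ₑ) + ‖c‖ₑ * volume B := by
        rw [lintegral_add_right _ measurable_const, setLIntegral_const]
    _ ≤ _ := by
        rw [two_mul]
        gcongr

/-- The `L¹` distance of a superharmonic function in the ball to a constant is controlled by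
the `L¹` norm of its radial derivative in an annulus. -/
lemma exists_lintegral_sub_const_le :
    ∃ C : ℝ, 0 < C ∧ ∀ u : Euc n → ℝ, ContDiffOn ℝ ∞ u (closedBall 0 1) →
      (∀ x ∈ ball (0 : Euc n) 1, Δ u x ≤ 0) →
      ∃ t : ℝ, ∫⁻ x in ball (0 : Euc n) 1, ‖u x - t‖ₑ ≤
        ENNReal.ofReal C * ∫⁻ x in ball (0 : Euc n) 1 \ ball 0 (1 / 2), ‖radialDeriv u x‖ₑ := by
  by_contra! hcon
  have hC : ∀ k : ℕ, (0 : ℝ) < k + 1 := fun k => by positivity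
  choose u hu hsup hlt using fun k : ℕ => hcon (k + 1) (hC k)
  set B := ball (0 : Euc n) 1 with hB
  set A := ball (0 : Euc n) 1 \ ball 0 (1 / 2) with hA
  have hBfin : volume B ≠ ⊤ := measure_ball_lt_top.ne
  have hBpos : 0 < volume.real B := by
    rw [Measure.real, ENNReal.toReal_pos_iff]
    exact ⟨measure_ball_pos _ _ one_pos, measure_ball_lt_top⟩
  have hint : ∀ k, IntegrableOn (u k) B := fun k =>
    ((hu k).continuousOn.integrableOn_compact (isCompact_closedBall 0 1)).mono_set
      ball_subset_closedBall
  set t : ℕ → ℝ := fun k => (volume.real B)⁻¹ * ∫ x in B, u k x with ht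
  have hint' : ∀ k, IntegrableOn (fun x => u k x - t k) B := fun k =>
    (hint k).sub (integrableOn_const hBfin)
  have hmean : ∀ k, ∫ x in B, (u k x - t k) = 0 := by
    intro k
    rw [integral_sub (hint k) (integrableOn_const hBfin)]
    simp only [ht, integral_const, measureReal_restrict_apply_univ, smul_eq_mul]
    field_simp
    ring
  set m : ℕ → ℝ≥0∞ := fun k => ∫⁻ x in B, ‖u k x - t k‖ₑ with hm
  have hmtop : ∀ k, m k ≠ ⊤ := fun k => (hint' k).2.ne
  -- The strict inequality in the negated claim rules out `m k = 0`, so dividing by `m k` is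
  -- legitimate.
  have hmpos : ∀ k, 0 < m k := fun k => lt_of_le_of_lt zero_le (hlt k (t k))
  set a : ℕ → ℝ := fun k => (m k).toReal⁻¹ with ha
  have hapos : ∀ k, 0 < a k := fun k => inv_pos.2 (ENNReal.toReal_pos (hmpos k).ne' (hmtop k))
  have haenorm : ∀ k, ‖a k‖ₑ = (m k)⁻¹ := fun k => by
    rw [Real.enorm_of_nonneg (hapos k).le, ha, ENNReal.ofReal_inv_of_pos
      (ENNReal.toReal_pos (hmpos k).ne' (hmtop k)), ENNReal.ofReal_toReal (hmtop k)]
  have hnorm : ∀ k, ∫⁻ x in B, ‖a k * (u k x - t k)‖ₑ = 1 := by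
    intro k
    simp_rw [enorm_mul]
    rw [lintegral_const_mul' _ _ enorm_ne_top, haenorm]
    exact ENNReal.inv_mul_cancel (hmpos k).ne' (hmtop k)
  have hrd : ∀ k : ℕ, ∫⁻ x in A, ‖radialDeriv (fun x => a k * (u k x - t k)) x‖ₑ ≤
      ((k : ℝ≥0∞) + 1)⁻¹ := by
    intro k
    simp_rw [radialDeriv_const_mul_sub_const, enorm_mul]
    rw [lintegral_const_mul' _ _ enorm_ne_top, haenorm]
    have h1 := (hlt k (t k)).le
    have h2 : ENNReal.ofReal ((k : ℝ) + 1) = (k : ℝ≥0∞) + 1 := by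
      rw [ENNReal.ofReal_add (by positivity) zero_le_one]
      simp
    rw [h2] at h1
    rw [ENNReal.le_inv_iff_mul_le]
    calc (m k)⁻¹ * (∫⁻ x in A, ‖radialDeriv (u k) x‖ₑ) * ((k : ℝ≥0∞) + 1)
        = (m k)⁻¹ * (((k : ℝ≥0∞) + 1) * ∫⁻ x in A, ‖radialDeriv (u k) x‖ₑ) := by ring
      _ ≤ (m k)⁻¹ * m k := mul_le_mul_right h1 _
      _ = 1 := ENNReal.inv_mul_cancel (hmpos k).ne' (hmtop k)
  have hlim : Tendsto (fun k : ℕ => ((k : ℝ≥0∞) + 1)⁻¹) atTop (𝓝 0) := by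
    have := (tendsto_add_atTop_iff_nat 1).2 ENNReal.tendsto_inv_nat_nhds_zero
    simpa using this
  obtain ⟨c, φ, -, hT⟩ := exists_subseq_superharmonic_tendsto_const
    (v := fun k x => a k * (u k x - t k))
    (fun k => contDiffOn_const.mul ((hu k).sub contDiffOn_const))
    (fun k x hx => by
      rw [laplacian_const_mul_sub_const]
      exact mul_nonpos_of_nonneg_of_nonpos (hapos k).le (hsup k x hx))
    (fun k => (hnorm k).le)
    (tendsto_of_tendsto_of_tendsto_of_le_of_le tendsto_const_nhds hlim (fun _ => zero_le) hrd)
  have hT2 := ENNReal.Tendsto.const_mul hT (Or.inr (ENNReal.ofNat_ne_top (n := 2)))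
  -- Mean zero and norm 1 give `1 ≤ 2 * ‖v - c‖` along the subsequence, whose limit reads `1 ≤ 0`.
  have hge := ge_of_tendsto hT2 (b := 1) (Eventually.of_forall fun k => by
    rw [← hnorm (φ k)]
    refine lintegral_enorm_le_two_mul_of_integral_eq_zero hBfin ((hint' (φ k)).const_mul _) ?_ c
    rw [integral_const_mul, hmean, mul_zero])
  simp at hge

end Normalization

theorem theorem1p3 (n : ℕ) (hn : 1 ≤ n) :
    ∃ C : ℝ, 0 < C ∧
      ∀ u : EuclideanSpace ℝ (Fin n) → ℝ,
        ContDiffOn ℝ ∞ u (closedBall 0 1) →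
        (∀ x ∈ ball (0 : EuclideanSpace ℝ (Fin n)) 1, Δ u x ≤ 0) →
        ∃ t : ℝ,
          L1norm (fun x => u x - t) (ball 0 1 \ ball 0 (1 / 2)) ≤
            ENNReal.ofReal C * L1norm (radialDeriv u) (ball 0 1 \ ball 0 (1 / 2)) ∧
          L1norm (fun x => u x - t) (ball 0 1) ≤
            ENNReal.ofReal C * L1norm (radialDeriv u) (ball 0 1) := by
  obtain ⟨C, hC, h⟩ := exists_lintegral_sub_const_le (n := n)
  refine ⟨C, hC, fun u hu hsup => ?_⟩
  obtain ⟨t, ht⟩ := h u hu hsup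
  refine ⟨t, ?_, ?_⟩ <;> simp only [L1norm, eLpNorm_one_eq_lintegral_enorm]
  -- The same `t` serves twice: shrink the domain on the left for the first estimate, enlarge it on
  -- the right for the second.
  · exact (lintegral_mono_set Set.sdiff_subset).trans ht
  · exact ht.trans (mul_le_mul_right (lintegral_mono_set Set.sdiff_subset) _)
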